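/- Let $k\ge 1$ be an integer, let $\mathcal S^{k-1}=\{v\in\mathbb R^k:\|v\|=1\}$, and let $\sigma$ be the surface area measure on $\mathcal S^{k-1}$. For $\kappa\in\mathbb R$ and $\theta\in\mathcal S^{k-1}$, the Fisher--von Mises--Langevin (FvML) distribution with concentration $\kappa$ and location $\theta$ is the probability measure on $\mathcal S^{k-1}$ whose $\sigma$-density is proportional to $x\mapsto\exp(\kappa\,x'\theta)$. Let ${\rm P}^{(n)}_{\rm unif}$ and ${\rm P}^{(n)}_{(\kappa,\theta)}$ denote the joint laws of $n$ i.i.d. observations $\mathbf X_1,\dots,\mathbf X_n$ that are, respectively, uniformly distributed on $\mathcal S^{k-1}$ and FvML distributed with parameters $\kappa,\theta$. Put $\bar{\mathbf X}=n^{-1}\sum_{i=1}^n\mathbf X_i$ and consider the Rayleigh statistic $$Q^{(n)}_{\rm unif}:=k\,n\,\|\bar{\mathbf X}\|^2 .$$ (i) Under ${\rm P}^{(n)}_{\rm unif}$, $Q^{(n)}_{\rm unif}$ converges in distribution, as $n\to\infty$, to the chi-square distribution with $k$ degrees of freedom. (ii) Let $(c^{(n)})_{n\ge1}$ be a sequence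 of positive real numbers converging to some $c\in\mathbb R$, and let $(\theta^{(n)})_{n\ge 1}$ be any sequence (for example a constant one) in $\mathcal S^{k-1}$. Under ${\rm P}^{(n)}_{(n^{-1/2}c^{(n)},\theta^{(n)})}$, $Q^{(n)}_{\rm unif}$ converges in distribution, as $n\to\infty$, to the non-central chi-square distribution with $k$ degrees of freedom and non-centrality parameter $c^2/k$, i.e. the law of $\sum_{i=1}^k Z_i^2$ with independent $Z_i\sim\mathcal N(\mu_i,1)$ and $\sum_{i=1}^k\mu_i^2=c^2/k$. -/

import Mathlib

open MeasureTheory ProbabilityTheory Filter Topology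

noncomputable section

/-- The unit sphere `S^{k-1}` of Euclidean space `ℝ^k`. -/
abbrev UnitSphere (k : ℕ) : Type :=
  Metric.sphere (0 : EuclideanSpace ℝ (Fin k)) 1

/-- The usual (unnormalised) surface area measure on `S^{k-1}`. -/
def surfaceArea (k : ℕ) : Measure (UnitSphere k) :=
  (volume : Measure (EuclideanSpace ℝ (Fin k))).toSphere

/-- The uniform distribution on `S^{k-1}`. -/
def uniformSphere (k : ℕ) : Measure (UnitSphere k) :=
  (surfaceArea k Set.univ)⁻¹ • surfaceArea k

/-- The FvML density `c_{k,κ} exp (κ x'θ)` with respect to the surface area measure; the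
normalising constant `c_{k,κ}` is the reciprocal of the integral of `exp (κ y'θ)`. -/
def fvmlDensity {k : ℕ} (κ : ℝ) (θ x : UnitSphere k) : ℝ :=
  (∫ y : UnitSphere k, Real.exp (κ * inner ℝ y.1 θ.1) ∂(surfaceArea k))⁻¹ *
    Real.exp (κ * inner ℝ x.1 θ.1)

/-- The Fisher-von Mises-Langevin distribution on `S^{k-1}` with concentration `κ` and
location `θ`. -/
def fvml {k : ℕ} (κ : ℝ) (θ : UnitSphere k) : Measure (UnitSphere k) :=
  (surfaceArea k).withDensity fun x => ENNReal.ofReal (fvmlDensity κ θ x)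

/-- The joint law of `n` i.i.d. observations with common law `P` on `S^{k-1}`. -/
abbrev sampleLaw {k : ℕ} (P : Measure (UnitSphere k)) (n : ℕ) :
    Measure (Fin n → UnitSphere k) :=
  Measure.pi fun _ => P

/-- The sample mean `n⁻¹ ∑ X_i` in `ℝ^k`. -/
def sampleMean {k n : ℕ} (x : Fin n → UnitSphere k) : EuclideanSpace ℝ (Fin k) :=
  (n : ℝ)⁻¹ • ∑ i, (x i).1

/-- The Rayleigh statistic `k n ‖X̄‖²`. -/
def rayleighStat {k n : ℕ} (x : Fin n → UnitSphere k) : ℝ :=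
  k * n * ‖sampleMean x‖ ^ 2

/-- The chi-square distribution with `k` degrees of freedom: the law of `∑ Z_i²` for independent
standard normal variables `Z_1, …, Z_k`. -/
def chiSquare (k : ℕ) : Measure ℝ :=
  (Measure.pi fun _ : Fin k => gaussianReal 0 1).map fun z => ∑ i, z i ^ 2

/-- The non-central chi-square distribution with `k ≥ 1` degrees of freedom and non-centrality
parameter `δ ≥ 0`: the law of `∑ Z_i²` for independent normal variables `Z_1, …, Z_k` with unit
variances and means whose squares sum to `δ`. The law does not depend on the choice of such means
(see `noncentralChiSquare_eq`), and `(√δ, 0, …, 0)` is chosen here. -/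
def noncentralChiSquare (k : ℕ) (δ : ℝ) : Measure ℝ :=
  (Measure.pi fun i : Fin k => gaussianReal (if (i : ℕ) = 0 then √δ else 0) 1).map
    fun z => ∑ i, z i ^ 2

instance isProbabilityMeasure_uniformSphere (k : ℕ) [NeZero k] :
    IsProbabilityMeasure (uniformSphere k) := by
  constructor
  have h0 : surfaceArea k Set.univ ≠ 0 := by
    rw [Ne, Measure.measure_univ_eq_zero]
    exact Measure.toSphere_ne_zero _
  have h1 : surfaceArea k Set.univ ≠ ⊤ := by
    unfold surfaceArea
    exact measure_ne_top _ _
  simp only [uniformSphere, Measure.smul_apply, smul_eq_mul]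
  exact ENNReal.inv_mul_cancel h0 h1

instance isProbabilityMeasure_fvml {k : ℕ} [NeZero k] (κ : ℝ) (θ : UnitSphere k) :
    IsProbabilityMeasure (fvml κ θ) := by
  have : IsFiniteMeasure (surfaceArea k) := by unfold surfaceArea; infer_instance
  have : NeZero (surfaceArea k) := ⟨Measure.toSphere_ne_zero _⟩
  have hi : Integrable (fun y : UnitSphere k => Real.exp (κ * inner ℝ y.1 θ.1))
      (surfaceArea k) := by
    have hc : Continuous fun y : UnitSphere k => Real.exp (κ * inner ℝ y.1 θ.1) := by fun_prop
    exact (BoundedContinuousFunction.mkOfCompact ⟨_, hc⟩).integrable _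
  have h := isProbabilityMeasure_tilted (μ := surfaceArea k)
    (f := fun y : UnitSphere k => κ * inner ℝ y.1 θ.1) hi
  convert h using 1
  simp only [fvml, fvmlDensity, Measure.tilted, div_eq_inv_mul]

instance isProbabilityMeasure_chiSquare (k : ℕ) : IsProbabilityMeasure (chiSquare k) :=
  Measure.isProbabilityMeasure_map (Measurable.aemeasurable (by fun_prop))

instance isProbabilityMeasure_noncentralChiSquare (k : ℕ) (δ : ℝ) :
    IsProbabilityMeasure (noncentralChiSquare k δ) :=
  Measure.isProbabilityMeasure_map (Measurable.aemeasurable (by fun_prop))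

theorem noncentralChiSquare_zero (k : ℕ) : noncentralChiSquare k 0 = chiSquare k := by
  simp [noncentralChiSquare, chiSquare]

theorem map_sum_sq_pi_gaussianReal (k : ℕ) (m : Fin k → ℝ) :
    (Measure.pi fun i : Fin k => gaussianReal (m i) 1).map (fun z => ∑ i, z i ^ 2) =
      (stdGaussian (EuclideanSpace ℝ (Fin k))).map fun z => ‖z + WithLp.toLp 2 m‖ ^ 2 := by
  have h : (Measure.pi fun i : Fin k => gaussianReal (m i) 1) =
      (Measure.pi fun _ : Fin k => gaussianReal 0 1).map (fun z i => z i + m i) := by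
    rw [Measure.pi_map_pi (μ := fun _ : Fin k => gaussianReal 0 1) (f := fun i x => x + m i)
      (fun i => Measurable.aemeasurable (by fun_prop))]
    congr 1
    ext1 i
    rw [gaussianReal_map_add_const]
    simp
  rw [h, Measure.map_map (by fun_prop) (by fun_prop), ← map_pi_eq_stdGaussian,
    Measure.map_map (by fun_prop) (by fun_prop)]
  congr 1
  ext1 z
  simp [EuclideanSpace.norm_sq_eq]

/-- The non-central chi-square law depends on the means only through the sum of their squares. -/
theorem noncentralChiSquare_eq (k : ℕ) [NeZero k] (m : Fin k → ℝ) :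
    (Measure.pi fun i : Fin k => gaussianReal (m i) 1).map (fun z => ∑ i, z i ^ 2) =
      noncentralChiSquare k (∑ i, m i ^ 2) := by
  set m' : Fin k → ℝ := fun i => if (i : ℕ) = 0 then √(∑ i, m i ^ 2) else 0 with hm'
  have hn : ‖WithLp.toLp 2 m‖ = ‖WithLp.toLp 2 m'‖ := by
    have hs : ∑ i, m' i ^ 2 = ∑ i, m i ^ 2 := by
      rw [Finset.sum_eq_single (0 : Fin k)]
      · simp [hm', Real.sq_sqrt (Finset.sum_nonneg fun i _ => sq_nonneg (m i))]
      · intro i _ hi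
        simp [hm', hi]
      · simp
    rw [EuclideanSpace.norm_eq, EuclideanSpace.norm_eq]
    simp [hs]
  have hr := Submodule.reflection_sub hn
  unfold noncentralChiSquare
  rw [map_sum_sq_pi_gaussianReal, map_sum_sq_pi_gaussianReal k m']
  set R := (Submodule.span ℝ {WithLp.toLp 2 m - WithLp.toLp 2 m'})ᗮ.reflection
  conv_rhs => rw [← stdGaussian_map R]
  rw [Measure.map_map (by fun_prop) (by fun_prop)]
  congr 1
  ext1 z
  simp only [Function.comp_apply]
  rw [← hr, ← map_add, LinearIsometryEquiv.norm_map]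

end

/-! The statistic is the squared norm of `√(k/n) ∑ X_i`, so it does not change when each sample is
moved by an isometry sending `θ n` to a fixed `θ₀`. The FvML law is an exponential tilt of the
uniform law, so the characteristic function of the rotated sum is an `n`-th power of a ratio of
exponential moments of the uniform law. By symmetry these moments have no linear term and a
quadratic term governed by the covariance `I/k`; hence the powers converge
(`tendsto_sphereExpMoment_pow`) and Lévy's theorem gives a Gaussian limit with mean `(c/√k) θ₀` and
identity covariance (`tendstoInDistribution_smul_sum_fvml`). Continuous mapping finishes; the
uniform case is concentration zero. -/

/-! ### Rotation invariance and moments of the uniform law -/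

/-- The action of a linear isometry on the unit sphere. -/
noncomputable def sphereMap {k : ℕ} (R : EuclideanSpace ℝ (Fin k) ≃ₗᵢ[ℝ] EuclideanSpace ℝ (Fin k))
    (x : UnitSphere k) : UnitSphere k :=
  ⟨R x.1, by simp⟩

open scoped Pointwise in
-- Surface area is, up to a constant, the volume of the cone over a set. Isometries commute with
-- forming cones and preserve volume.
theorem measurePreserving_sphereMap_surfaceArea {k : ℕ}
    (R : EuclideanSpace ℝ (Fin k) ≃ₗᵢ[ℝ] EuclideanSpace ℝ (Fin k)) :
    MeasurePreserving (sphereMap R) (surfaceArea k) (surfaceArea k) := by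
  have hc : Continuous (sphereMap R) := by unfold sphereMap; fun_prop
  refine ⟨hc.measurable, ?_⟩
  ext s hs
  rw [Measure.map_apply hc.measurable hs, surfaceArea, Measure.toSphere_apply' _ hs,
    Measure.toSphere_apply' _ (hc.measurable hs)]
  congr 1
  have hset : (Set.Ioo (0 : ℝ) 1 • (Subtype.val '' (sphereMap R ⁻¹' s)) :
      Set (EuclideanSpace ℝ (Fin k))) = R ⁻¹' (Set.Ioo (0 : ℝ) 1 • (Subtype.val '' s)) := by
    ext y
    simp only [Set.mem_smul, Set.mem_image, Set.mem_preimage]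
    constructor
    · rintro ⟨r, hr, _, ⟨x, hx, rfl⟩, rfl⟩
      exact ⟨r, hr, _, ⟨_, hx, rfl⟩, by simp [sphereMap]⟩
    · rintro ⟨r, hr, _, ⟨x, hx, rfl⟩, h⟩
      refine ⟨r, hr, _, ⟨sphereMap R.symm x, ?_, rfl⟩, ?_⟩
      · simpa [sphereMap] using hx
      · apply R.injective
        rw [← h]
        simp [sphereMap]
  rw [hset]
  exact R.measurePreserving.measure_preimage_emb R.toHomeomorph.measurableEmbedding _

theorem measurePreserving_sphereMap_uniformSphere {k : ℕ}
    (R : EuclideanSpace ℝ (Fin k) ≃ₗᵢ[ℝ] EuclideanSpace ℝ (Fin k)) :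
    MeasurePreserving (sphereMap R) (uniformSphere k) (uniformSphere k) :=
  (measurePreserving_sphereMap_surfaceArea R).smul_measure _

theorem integral_comp_sphereMap {k : ℕ} {F : Type*} [NormedAddCommGroup F] [NormedSpace ℝ F]
    (R : EuclideanSpace ℝ (Fin k) ≃ₗᵢ[ℝ] EuclideanSpace ℝ (Fin k)) {f : UnitSphere k → F}
    (hf : Continuous f) :
    ∫ x, f (sphereMap R x) ∂(uniformSphere k) = ∫ x, f x ∂(uniformSphere k) := by
  have h := measurePreserving_sphereMap_uniformSphere R
  conv_rhs => rw [← h.map_eq]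
  rw [integral_map h.measurable.aemeasurable hf.aestronglyMeasurable]

theorem Continuous.integrable_sphere {k : ℕ} {F : Type*} [NormedAddCommGroup F]
    {f : UnitSphere k → F} (hf : Continuous f) (μ : Measure (UnitSphere k)) [IsFiniteMeasure μ] :
    Integrable f μ :=
  hf.integrable_of_hasCompactSupport (.of_compactSpace f)

theorem integral_inner_uniformSphere {k : ℕ} (a : EuclideanSpace ℝ (Fin k)) :
    ∫ x : UnitSphere k, inner ℝ x.1 a ∂(uniformSphere k) = 0 := by
  have h := integral_comp_sphereMap (LinearIsometryEquiv.neg ℝ)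
    (f := fun x : UnitSphere k => inner ℝ x.1 a) (by fun_prop)
  simp only [sphereMap, LinearIsometryEquiv.coe_neg, inner_neg_left, integral_neg] at h
  linarith

theorem integral_inner_sq_eq_of_norm_eq {k : ℕ} {a b : EuclideanSpace ℝ (Fin k)}
    (h : ‖a‖ = ‖b‖) :
    ∫ x : UnitSphere k, inner ℝ x.1 a ^ 2 ∂(uniformSphere k) =
      ∫ x : UnitSphere k, inner ℝ x.1 b ^ 2 ∂(uniformSphere k) := by
  have hr := Submodule.reflection_sub h
  set R := (Submodule.span ℝ {a - b})ᗮ.reflection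
  rw [← integral_comp_sphereMap R (f := fun x : UnitSphere k => inner ℝ x.1 b ^ 2) (by fun_prop)]
  simp only [sphereMap, ← hr, LinearIsometryEquiv.inner_map_map]

/-- By invariance `a` may be replaced by `‖a‖ e_i` for every `i`; summing over `i` and using `∑ x_i²
= 1` fixes the common value. -/
theorem integral_inner_sq_uniformSphere {k : ℕ} [NeZero k] (a : EuclideanSpace ℝ (Fin k)) :
    ∫ x : UnitSphere k, inner ℝ x.1 a ^ 2 ∂(uniformSphere k) = ‖a‖ ^ 2 / k := by
  have hk : (k : ℝ) ≠ 0 := Nat.cast_ne_zero.2 (NeZero.ne k)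
  have hb (i : Fin k) : ∫ x : UnitSphere k, inner ℝ x.1 a ^ 2 ∂(uniformSphere k) =
      ‖a‖ ^ 2 * ∫ x : UnitSphere k, x.1 i ^ 2 ∂(uniformSphere k) := by
    rw [integral_inner_sq_eq_of_norm_eq (b := ‖a‖ • EuclideanSpace.single i 1)
      (by simp [norm_smul]), ← integral_const_mul]
    simp [inner_smul_right, EuclideanSpace.inner_single_right, mul_pow]
  have hs : ∑ i : Fin k, ∫ x : UnitSphere k, x.1 i ^ 2 ∂(uniformSphere k) = 1 := by
    rw [← integral_finsetSum _ fun i _ => Continuous.integrable_sphere (by fun_prop) _]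
    have : ∀ x : UnitSphere k, ∑ i, x.1 i ^ 2 = 1 := fun x => by
      rw [← EuclideanSpace.real_norm_sq_eq, norm_eq_of_mem_sphere x, one_pow]
    simp [this]
  have := Finset.sum_congr rfl fun i (_ : i ∈ Finset.univ) => hb i
  rw [← Finset.mul_sum, hs, Finset.sum_const] at this
  simp only [Finset.card_univ, Fintype.card_fin, nsmul_eq_mul] at this
  field_simp
  linarith

theorem integral_inner_mul_inner_uniformSphere {k : ℕ} [NeZero k]
    (a b : EuclideanSpace ℝ (Fin k)) :
    ∫ x : UnitSphere k, inner ℝ x.1 a * inner ℝ x.1 b ∂(uniformSphere k) =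
      inner ℝ a b / k := by
  have h : ∀ x : UnitSphere k, inner ℝ x.1 a * inner ℝ x.1 b =
      (inner ℝ x.1 (a + b) ^ 2 - inner ℝ x.1 (a - b) ^ 2) / 4 := fun x => by
    rw [inner_add_right, inner_sub_right]; ring
  simp_rw [h]
  rw [integral_div, integral_sub (Continuous.integrable_sphere (by fun_prop) _)
    (Continuous.integrable_sphere (by fun_prop) _), integral_inner_sq_uniformSphere,
    integral_inner_sq_uniformSphere, norm_add_sq_real, norm_sub_sq_real]
  ring

/-! ### Expansion of exponential moments and their powers -/

/-- The exponential moment of the uniform distribution on the sphere at `a + i b`. -/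
noncomputable def sphereExpMoment {k : ℕ} (a b : EuclideanSpace ℝ (Fin k)) : ℂ :=
  ∫ x : UnitSphere k, Complex.exp ((inner ℝ x.1 a : ℝ) + (inner ℝ x.1 b : ℝ) * Complex.I)
    ∂(uniformSphere k)

/-- Second-order Taylor expansion of `exp` at `z x`, with `‖z x‖ ≤ ‖a‖ + ‖b‖`: the first moment of
`z` vanishes, the second is explicit, and the remainder is cubic. -/
theorem norm_sphereExpMoment_sub_le {k : ℕ} [NeZero k] (a b : EuclideanSpace ℝ (Fin k)) :
    ‖sphereExpMoment a b - 1 -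
        ((‖a‖ ^ 2 - ‖b‖ ^ 2 : ℝ) + 2 * (inner ℝ a b : ℝ) * Complex.I) / (2 * k)‖ ≤
      (‖a‖ + ‖b‖) ^ 3 * Real.exp (‖a‖ + ‖b‖) := by
  set z : UnitSphere k → ℂ := fun x => (inner ℝ x.1 a : ℝ) + (inner ℝ x.1 b : ℝ) * Complex.I
    with hz
  have hzc : Continuous z := by fun_prop
  have hzb (x : UnitSphere k) : ‖z x‖ ≤ ‖a‖ + ‖b‖ := by
    refine (norm_add_le _ _).trans (add_le_add ?_ ?_)
    · simpa using abs_real_inner_le_norm x.1 a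
    · simpa using abs_real_inner_le_norm x.1 b
  have hi {f : UnitSphere k → ℂ} (hf : Continuous f) : Integrable f (uniformSphere k) :=
    hf.integrable_sphere _
  have hir {f : UnitSphere k → ℝ} (hf : Continuous f) : Integrable f (uniformSphere k) :=
    hf.integrable_sphere _
  have h1 : ∫ x, z x ∂(uniformSphere k) = 0 := by
    simp only [hz]
    rw [integral_add (hi (by fun_prop)) (hi (by fun_prop)), integral_mul_const,
      integral_complex_ofReal, integral_complex_ofReal, integral_inner_uniformSphere,
      integral_inner_uniformSphere]
    simp
  have h2 : ∫ x, z x ^ 2 ∂(uniformSphere k) =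
      ((‖a‖ ^ 2 - ‖b‖ ^ 2 : ℝ) + 2 * (inner ℝ a b : ℝ) * Complex.I) / k := by
    have : ∀ x, z x ^ 2 = ((inner ℝ x.1 a ^ 2 - inner ℝ x.1 b ^ 2 : ℝ) : ℂ) +
        ((inner ℝ x.1 a * inner ℝ x.1 b : ℝ) : ℂ) * (2 * Complex.I) := fun x => by
      simp only [hz]
      push_cast
      ring_nf
      simp
      ring
    simp_rw [this]
    rw [integral_add (hi (by fun_prop)) (hi (by fun_prop)), integral_mul_const,
      integral_complex_ofReal, integral_complex_ofReal, integral_inner_mul_inner_uniformSphere,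
      integral_sub (hir (by fun_prop)) (hir (by fun_prop)), integral_inner_sq_uniformSphere,
      integral_inner_sq_uniformSphere]
    push_cast
    ring
  have h3 : sphereExpMoment a b - 1 -
        ((‖a‖ ^ 2 - ‖b‖ ^ 2 : ℝ) + 2 * (inner ℝ a b : ℝ) * Complex.I) / (2 * k) =
      ∫ x, (Complex.exp (z x) - (1 + z x + z x ^ 2 / 2)) ∂(uniformSphere k) := by
    rw [integral_sub (hi (by fun_prop)) (hi (by fun_prop)),
      integral_add (hi (by fun_prop)) (hi (by fun_prop)),
      integral_add (hi (by fun_prop)) (hi (by fun_prop)), integral_div, h1, h2]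
    simp only [sphereExpMoment, hz, integral_const, probReal_univ, one_smul]
    ring
  rw [h3]
  refine (norm_integral_le_of_norm_le_const (C := (‖a‖ + ‖b‖) ^ 3 * Real.exp (‖a‖ + ‖b‖))
    (.of_forall fun x => ?_)).trans (by simp)
  have := Complex.norm_exp_sub_sum_le_norm_mul_exp (z x) 3
  simp only [Finset.sum_range_succ, Finset.sum_range_zero, Nat.factorial] at this
  norm_num at this
  refine this.trans ?_
  have := hzb x
  gcongr

theorem tendsto_sphereExpMoment_pow {k : ℕ} [NeZero k] {a b : ℕ → EuclideanSpace ℝ (Fin k)}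
    {A B C : ℝ} (ha : Tendsto (fun n => ‖a n‖) atTop (𝓝 A))
    (hb : Tendsto (fun n => ‖b n‖) atTop (𝓝 B))
    (hab : Tendsto (fun n => (inner ℝ (a n) (b n) : ℝ)) atTop (𝓝 C)) :
    Tendsto (fun n : ℕ => sphereExpMoment ((√(n : ℝ))⁻¹ • a n) ((√(n : ℝ))⁻¹ • b n) ^ n) atTop
      (𝓝 (Complex.exp (((A ^ 2 - B ^ 2 : ℝ) + 2 * C * Complex.I) / (2 * k)))) := by
  set m : ℕ → ℂ := fun n => sphereExpMoment ((√(n : ℝ))⁻¹ • a n) ((√(n : ℝ))⁻¹ • b n) with hm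
  set q : ℕ → ℂ := fun n =>
    ((‖a n‖ ^ 2 - ‖b n‖ ^ 2 : ℝ) + 2 * (inner ℝ (a n) (b n) : ℝ) * Complex.I) / (2 * k) with hq
  have hs : Tendsto (fun n : ℕ => (√(n : ℝ))⁻¹) atTop (𝓝 0) :=
    tendsto_inv_atTop_zero.comp (Real.tendsto_sqrt_atTop.comp tendsto_natCast_atTop_atTop)
  have hqt : Tendsto q atTop
      (𝓝 (((A ^ 2 - B ^ 2 : ℝ) + 2 * C * Complex.I) / (2 * k))) := by
    refine Tendsto.div_const (Tendsto.add ?_ ?_) _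
    · exact (Complex.continuous_ofReal.tendsto _).comp ((ha.pow 2).sub (hb.pow 2))
    · exact (((Complex.continuous_ofReal.tendsto _).comp hab).const_mul 2).mul_const _
  -- The cubic remainder at scale `n^{-1/2}`, multiplied by `n`, is of order `n^{-1/2}`.
  have herr : Tendsto (fun n : ℕ => n * (m n - 1) - q n) atTop (𝓝 0) := by
    have hlim : Tendsto (fun n : ℕ => (√(n : ℝ))⁻¹ * ((‖a n‖ + ‖b n‖) ^ 3 *
        Real.exp ((√(n : ℝ))⁻¹ * (‖a n‖ + ‖b n‖)))) atTop
        (𝓝 (0 * ((A + B) ^ 3 * Real.exp (0 * (A + B))))) :=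
      hs.mul (((ha.add hb).pow 3).mul
        ((Real.continuous_exp.tendsto _).comp (hs.mul (ha.add hb))))
    rw [zero_mul] at hlim
    refine squeeze_zero_norm' ?_ hlim
    filter_upwards [eventually_gt_atTop 0] with n hn
    have hn0 : (0 : ℝ) < n := Nat.cast_pos.2 hn
    have hsq : √(n : ℝ) ^ 2 = n := Real.sq_sqrt hn0.le
    have hsp : 0 < √(n : ℝ) := Real.sqrt_pos.2 hn0
    have h := norm_sphereExpMoment_sub_le ((√(n : ℝ))⁻¹ • a n) ((√(n : ℝ))⁻¹ • b n)
    have e : n * (m n - 1) - q n = n * (m n - 1 -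
        ((‖(√(n : ℝ))⁻¹ • a n‖ ^ 2 - ‖(√(n : ℝ))⁻¹ • b n‖ ^ 2 : ℝ) +
          2 * (inner ℝ ((√(n : ℝ))⁻¹ • a n) ((√(n : ℝ))⁻¹ • b n) : ℝ) * Complex.I) / (2 * k)) := by
      have hk : (k : ℂ) ≠ 0 := Nat.cast_ne_zero.2 (NeZero.ne k)
      have hnC : (n : ℂ) ≠ 0 := Nat.cast_ne_zero.2 hn.ne'
      have e1 : (‖(√(n : ℝ))⁻¹ • a n‖ ^ 2 - ‖(√(n : ℝ))⁻¹ • b n‖ ^ 2 : ℝ) =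
          (n : ℝ)⁻¹ * (‖a n‖ ^ 2 - ‖b n‖ ^ 2) := by
        rw [norm_smul, norm_smul, mul_pow, mul_pow, Real.norm_eq_abs, sq_abs, inv_pow, hsq]; ring
      have e2 : (inner ℝ ((√(n : ℝ))⁻¹ • a n) ((√(n : ℝ))⁻¹ • b n) : ℝ) =
          (n : ℝ)⁻¹ * inner ℝ (a n) (b n) := by
        rw [real_inner_smul_left, real_inner_smul_right, ← mul_assoc, ← sq, inv_pow, hsq]
      rw [e1, e2, hq]
      push_cast
      field_simp
    rw [e, norm_mul, Complex.norm_natCast]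
    refine (mul_le_mul_of_nonneg_left h hn0.le).trans (le_of_eq ?_)
    rw [norm_smul, norm_smul, Real.norm_of_nonneg (inv_pos.2 hsp).le, ← mul_add, mul_pow]
    nth_rewrite 1 [← hsq]
    field_simp
  have := Complex.tendsto_one_add_pow_exp_of_tendsto
    (g := fun n => m n - 1) (by simpa using herr.add hqt)
  simpa using this

/-! ### The FvML law as a tilt of the uniform law -/

theorem surfaceArea_real_univ_ne_zero (k : ℕ) [NeZero k] :
    (surfaceArea k).real Set.univ ≠ 0 := by
  refine ENNReal.toReal_ne_zero.2 ⟨?_, ?_⟩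
  · rw [Ne, Measure.measure_univ_eq_zero]
    exact Measure.toSphere_ne_zero _
  · unfold surfaceArea
    exact measure_ne_top _ _

theorem integral_surfaceArea {k : ℕ} [NeZero k] {F : Type*} [NormedAddCommGroup F]
    [NormedSpace ℝ F] (f : UnitSphere k → F) :
    ∫ x, f x ∂(surfaceArea k) =
      (surfaceArea k).real Set.univ • ∫ x, f x ∂(uniformSphere k) := by
  rw [uniformSphere, integral_smul_measure, ENNReal.toReal_inv, ← measureReal_def, smul_smul,
    mul_inv_cancel₀ (surfaceArea_real_univ_ne_zero k), one_smul]

theorem integral_fvml {k : ℕ} [NeZero k] (κ : ℝ) (θ : UnitSphere k) (f : UnitSphere k → ℂ) :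
    ∫ x, f x ∂(fvml κ θ) =
      (∫ x, Complex.exp (κ * (inner ℝ x.1 θ.1 : ℝ)) * f x ∂(uniformSphere k)) /
        ∫ x, Complex.exp (κ * (inner ℝ x.1 θ.1 : ℝ)) ∂(uniformSphere k) := by
  have hd : ∀ x, 0 ≤ fvmlDensity κ θ x := fun x =>
    mul_nonneg (inv_nonneg.2 (integral_nonneg fun y => (Real.exp_pos _).le)) (Real.exp_pos _).le
  have hm : Measurable fun x => ENNReal.ofReal (fvmlDensity κ θ x) := by
    unfold fvmlDensity
    exact ENNReal.measurable_ofReal.comp (Continuous.measurable (by fun_prop))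
  have hs : ((surfaceArea k).real Set.univ : ℂ) ≠ 0 :=
    Complex.ofReal_ne_zero.2 (surfaceArea_real_univ_ne_zero k)
  rw [fvml, integral_withDensity_eq_integral_toReal_smul hm (by simp), integral_surfaceArea]
  have hx (x : UnitSphere k) : (ENNReal.ofReal (fvmlDensity κ θ x)).toReal • f x =
      ((∫ y : UnitSphere k, Real.exp (κ * inner ℝ y.1 θ.1) ∂(surfaceArea k) : ℝ) : ℂ)⁻¹ *
        (Complex.exp (κ * (inner ℝ x.1 θ.1 : ℝ)) * f x) := by
    rw [ENNReal.toReal_ofReal (hd x), fvmlDensity, Complex.real_smul]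
    push_cast
    ring
  simp_rw [hx]
  rw [integral_const_mul, ← integral_complex_ofReal, integral_surfaceArea]
  simp only [Complex.real_smul, Complex.ofReal_exp, Complex.ofReal_mul]
  field_simp

theorem fvml_zero {k : ℕ} [NeZero k] (θ : UnitSphere k) : fvml 0 θ = uniformSphere k := by
  have : IsFiniteMeasure (surfaceArea k) := by unfold surfaceArea; infer_instance
  have h0 : surfaceArea k Set.univ ≠ 0 := by
    rw [Ne, Measure.measure_univ_eq_zero]
    exact Measure.toSphere_ne_zero _
  simp only [fvml, fvmlDensity, uniformSphere, zero_mul, Real.exp_zero, integral_const, smul_eq_mul,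
    mul_one, withDensity_const]
  rw [measureReal_def, ← ENNReal.toReal_inv, ENNReal.ofReal_toReal (ENNReal.inv_ne_top.2 h0)]

/-! ### Convergence of the rotated normalised sum -/

theorem charFun_map_smul_sum {k n : ℕ} (P : Measure (UnitSphere k)) [IsProbabilityMeasure P]
    (r : ℝ) (R : EuclideanSpace ℝ (Fin k) ≃ₗᵢ[ℝ] EuclideanSpace ℝ (Fin k))
    (t : EuclideanSpace ℝ (Fin k)) :
    charFun ((sampleLaw P n).map fun x => r • ∑ i, R (x i).1) t =
      (∫ x, Complex.exp ((inner ℝ x.1 (r • R.symm t) : ℝ) * Complex.I) ∂P) ^ n := by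
  rw [charFun_apply, integral_map (Measurable.aemeasurable (by fun_prop))
    (Continuous.aestronglyMeasurable (by fun_prop))]
  have h (x : Fin n → UnitSphere k) :
      Complex.exp ((inner ℝ (r • ∑ i, R (x i).1) t : ℝ) * Complex.I) =
        ∏ i, Complex.exp ((inner ℝ (x i).1 (r • R.symm t) : ℝ) * Complex.I) := by
    rw [← Complex.exp_sum, ← Finset.sum_mul, ← Complex.ofReal_sum, ← sum_inner,
      inner_smul_left, inner_smul_right, ← R.inner_map_map (∑ i, (x i).1)]
    simp
  simp_rw [h]
  rw [integral_fintype_prod_eq_pow (ι := Fin n)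
    (fun x : UnitSphere k => Complex.exp ((inner ℝ x.1 (r • R.symm t) : ℝ) * Complex.I))]
  simp

theorem rayleighStat_eq_norm_sq {k n : ℕ}
    (R : EuclideanSpace ℝ (Fin k) ≃ₗᵢ[ℝ] EuclideanSpace ℝ (Fin k)) (x : Fin n → UnitSphere k) :
    rayleighStat x = ‖((√(n : ℝ))⁻¹ * √(k : ℝ)) • ∑ i, R (x i).1‖ ^ 2 := by
  rw [rayleighStat, sampleMean, ← map_sum, norm_smul, norm_smul, R.norm_map, mul_pow, mul_pow,
    Real.norm_eq_abs, Real.norm_eq_abs, sq_abs, sq_abs, mul_pow, inv_pow, inv_pow,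
    Real.sq_sqrt (Nat.cast_nonneg _), Real.sq_sqrt (Nat.cast_nonneg _)]
  rcases n.eq_zero_or_pos with rfl | hn
  · simp
  · field_simp

/-- By `integral_fvml` this is a ratio of exponential moments with real part `cn n • θ n`; the
normalising constant is the case `b = 0`, and its limit cancels the `c²` term. -/
theorem tendsto_integral_fvml_pow {k : ℕ} [NeZero k] {c : ℝ} {cn : ℕ → ℝ}
    (hc : Tendsto cn atTop (𝓝 c)) {θ : ℕ → UnitSphere k} {b : ℕ → EuclideanSpace ℝ (Fin k)}
    {B C : ℝ} (hb : ∀ n, ‖b n‖ = B) (hC : ∀ n, inner ℝ (θ n).1 (b n) = C) :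
    Tendsto (fun n : ℕ =>
      (∫ x, Complex.exp ((inner ℝ x.1 ((√(n : ℝ))⁻¹ • b n) : ℝ) * Complex.I)
        ∂(fvml ((√(n : ℝ))⁻¹ * cn n) (θ n))) ^ n) atTop
      (𝓝 (Complex.exp ((-B ^ 2 + 2 * c * C * Complex.I) / (2 * k)))) := by
  have ha : Tendsto (fun n => ‖cn n • (θ n).1‖) atTop (𝓝 |c|) := by
    simpa [norm_smul] using hc.abs
  have hnum := tendsto_sphereExpMoment_pow ha (b := b) (B := B) (C := c * C)
    (by simp [hb]) (by simpa [inner_smul_left, hC] using hc.mul_const C)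
  have hden := tendsto_sphereExpMoment_pow ha (b := fun _ => 0) (B := 0) (C := 0)
    (by simp) (by simp)
  have h := hnum.div hden (Complex.exp_ne_zero _)
  rw [← Complex.exp_sub] at h
  convert! h using 2 with n
  · rw [integral_fvml, Pi.div_apply, ← div_pow]
    congr 2
    · refine integral_congr_ae (.of_forall fun x => ?_)
      simp only [← Complex.exp_add, inner_smul_right]
      push_cast
      ring_nf
    · refine integral_congr_ae (.of_forall fun x => ?_)
      simp [inner_smul_right]
      ring_nf
  · congr 1
    rw [sq_abs]
    push_cast
    ring

theorem tendstoInDistribution_smul_sum_fvml {k : ℕ} [NeZero k] {c : ℝ} {cn : ℕ → ℝ}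
    (hc : Tendsto cn atTop (𝓝 c)) {θ : ℕ → UnitSphere k} {θ₀ : UnitSphere k}
    {R : ℕ → EuclideanSpace ℝ (Fin k) ≃ₗᵢ[ℝ] EuclideanSpace ℝ (Fin k)}
    (hR : ∀ n, R n (θ n).1 = θ₀.1) :
    TendstoInDistribution (fun (n : ℕ) (x : Fin n → UnitSphere k) =>
        ((√(n : ℝ))⁻¹ * √(k : ℝ)) • ∑ i, R n (x i).1) atTop
      (fun z => z + (c / √(k : ℝ)) • θ₀.1)
      (fun n => sampleLaw (fvml ((√(n : ℝ))⁻¹ * cn n) (θ n)) n)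
      (stdGaussian (EuclideanSpace ℝ (Fin k))) where
  forall_aemeasurable n := Measurable.aemeasurable (by fun_prop)
  tendsto := by
    refine ProbabilityMeasure.tendsto_iff_tendsto_charFun.2 fun t => ?_
    have h := tendsto_integral_fvml_pow hc (θ := θ) (b := fun n => √(k : ℝ) • (R n).symm t)
      (B := √(k : ℝ) * ‖t‖) (C := √(k : ℝ) * inner ℝ θ₀.1 t)
      (fun n => by simp [norm_smul])
      (fun n => by rw [inner_smul_right, ← (R n).inner_map_map, hR]; simp)
    have hk : (√(k : ℝ) : ℂ) ^ 2 = k := by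
      rw [← Complex.ofReal_pow, Real.sq_sqrt (Nat.cast_nonneg _), Complex.ofReal_natCast]
    have hk0 : (√(k : ℝ) : ℂ) ≠ 0 := by
      rw [Complex.ofReal_ne_zero, Real.sqrt_ne_zero']
      exact Nat.cast_pos.2 (NeZero.pos k)
    convert! h using 2 with n
    · rw [ProbabilityMeasure.coe_mk, charFun_map_smul_sum]
      simp only [smul_smul]
    · rw [ProbabilityMeasure.coe_mk, charFun_map_add_const, charFun_stdGaussian, ← Complex.exp_add,
        real_inner_smul_left]
      congr 1
      rw [← hk]
      push_cast
      field_simp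

/-! ### Passage to the Rayleigh statistic -/

theorem map_norm_sq_stdGaussian_add {k : ℕ} [NeZero k] (m : EuclideanSpace ℝ (Fin k)) :
    (stdGaussian (EuclideanSpace ℝ (Fin k))).map (fun z => ‖z + m‖ ^ 2) =
      noncentralChiSquare k (‖m‖ ^ 2) := by
  have h := noncentralChiSquare_eq k m.ofLp
  rw [map_sum_sq_pi_gaussianReal] at h
  rw [EuclideanSpace.real_norm_sq_eq, ← h]

/-- The laws `P` and `Q` enter through equations so that the uniform and chi-square laws, which are
only propositionally the case `c = 0`, can be substituted directly. -/
theorem tendstoInDistribution_rayleighStat_fvml {k : ℕ} [NeZero k] {c : ℝ} {cn : ℕ → ℝ}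
    (hc : Tendsto cn atTop (𝓝 c)) (θ : ℕ → UnitSphere k) (P : ℕ → Measure (UnitSphere k))
    [∀ n, IsProbabilityMeasure (P n)] (hP : ∀ n : ℕ, P n = fvml ((√(n : ℝ))⁻¹ * cn n) (θ n))
    (Q : Measure ℝ) [IsProbabilityMeasure Q] (hQ : Q = noncentralChiSquare k (c ^ 2 / k)) :
    TendstoInDistribution (fun n : ℕ => (rayleighStat : (Fin n → UnitSphere k) → ℝ)) atTop
      (id : ℝ → ℝ) (fun n : ℕ => sampleLaw (P n) n) Q := by
  obtain rfl : P = fun n : ℕ => fvml ((√(n : ℝ))⁻¹ * cn n) (θ n) := funext hP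
  have hR (n : ℕ) : ∃ R : EuclideanSpace ℝ (Fin k) ≃ₗᵢ[ℝ] EuclideanSpace ℝ (Fin k),
      R (θ n).1 = (θ 0).1 :=
    -- Two vectors of equal norm are exchanged by the reflection in the hyperplane orthogonal to
    -- their difference.
    ⟨_, Submodule.reflection_sub (by simp)⟩
  choose R hR using hR
  have h := (tendstoInDistribution_smul_sum_fvml hc hR).continuous_comp
    (g := fun z => ‖z‖ ^ 2) (by fun_prop)
  have he (n : ℕ) : (rayleighStat : (Fin n → UnitSphere k) → ℝ) =
      (fun z => ‖z‖ ^ 2) ∘ fun x => ((√(n : ℝ))⁻¹ * √(k : ℝ)) • ∑ i, R n (x i).1 :=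
    funext fun x => rayleighStat_eq_norm_sq (R n) x
  simp_rw [he]
  refine ⟨h.forall_aemeasurable, aemeasurable_id, ?_⟩
  convert! h.tendsto using 2
  refine congrArg 𝓝 (Subtype.ext ?_)
  change Q.map id = (stdGaussian _).map fun z => ‖z + (c / √(k : ℝ)) • (θ 0).1‖ ^ 2
  rw [Measure.map_id, hQ, map_norm_sq_stdGaussian_add]
  congr 1
  rw [norm_smul, norm_eq_of_mem_sphere, mul_one, Real.norm_eq_abs, sq_abs, div_pow,
    Real.sq_sqrt (Nat.cast_nonneg _)]

theorem mainTheorem3 (k : ℕ) [NeZero k] :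
    TendstoInDistribution (fun n : ℕ => (rayleighStat : (Fin n → UnitSphere k) → ℝ)) atTop
        (id : ℝ → ℝ) (fun n : ℕ => sampleLaw (uniformSphere k) n) (chiSquare k) ∧
      ∀ (c : ℝ) (cn : ℕ → ℝ) (θ : ℕ → UnitSphere k),
        (∀ n, 1 ≤ n → 0 < cn n) → Tendsto cn atTop (𝓝 c) →
        TendstoInDistribution (fun n : ℕ => (rayleighStat : (Fin n → UnitSphere k) → ℝ)) atTop
          (id : ℝ → ℝ) (fun n : ℕ => sampleLaw (fvml ((√(n : ℝ))⁻¹ * cn n) (θ n)) n)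
          (noncentralChiSquare k (c ^ 2 / k)) := by
  refine ⟨?_, fun c cn θ _ hc =>
    tendstoInDistribution_rayleighStat_fvml hc θ _ (fun _ => rfl) _ rfl⟩
  -- At concentration zero the location is immaterial, so any point of the sphere serves.
  have θ : UnitSphere k := ⟨EuclideanSpace.single 0 1, by simp⟩
  exact tendstoInDistribution_rayleighStat_fvml (cn := fun _ => 0) tendsto_const_nhds
    (fun _ => θ) (fun _ => uniformSphere k) (fun n => by rw [mul_zero, fvml_zero]) _
    (by simp [noncentralChiSquare_zero])
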